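/- **Setting.** Let $A<B$ be real numbers, let $\eta(x,\theta)$ be a real-valued regression function on $[A,B]\times\Theta$, $\Theta\subset\mathbb R^p$, continuous and differentiable in $\theta$. Fix $\theta\in\Theta$. A *design* is a probability measure on $[A,B]$ with finite support; its information matrix is $$M(\xi,\theta)=\int_A^B \Big(\frac{\partial}{\partial\theta}\eta(x,\theta)\Big)\Big(\frac{\partial}{\partial\theta}\eta(x,\theta)\Big)^T d\xi(x).$$ Suppose that $M(\xi,\theta)=P(\theta)\,C(\xi,\theta)\,P(\theta)^T$ for all designs $\xi$, where $P(\theta)$ is a nonsingular $p\times p$ matrix not depending on $\xi$ and $C(\xi,\theta)=\big(\int_A^B\Psi_{ij}(x)\,d\xi(x)\big)_{i,j=1}^p$ for functions $\Psi_{ij}:[A,B]\to\mathbb R$. Let $k\ge 1$, let $\Psi_1,\dots,\Psi_k$ be the distinct nonconstant functions among the $\Psi_{ij}$, listed in some order, and put $\Psi_0=1$. Assume (D) there is $l\in\{1,\dots,p\}$ with $\Psi_k=\Psi_{ll}$ and $\Psi_{ij}\ne\Psi_k$ for all $(i,j)\ne(l,l)$. Continuous functions $u_0,\dots,u_m:[A,B]\to\mathbb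 R$ form a *Chebyshev system* if $\det\big(u_i(x_j)\big)_{i,j=0}^m>0$ for all $A\le x_0<\dots<x_m\le B$. The *index* $I(\xi)$ of a design is the number of its support points, where the boundary points $A$ and $B$, if they are support points, are counted by $1/2$ only. Matrices are compared in the Loewner ordering. **Theorem 3.1.** (1) If $\{\Psi_0,\dots,\Psi_{k-1}\}$ and $\{\Psi_0,\dots,\Psi_{k-1},\Psi_k\}$ are Chebyshev systems, then for every design $\xi$ there is a design $\xi^+$ with at most $\frac{k+2}{2}$ support points such that $M(\xi^+,\theta)\ge M(\xi,\theta)$, and $\xi^+$ can be chosen such that the following holds. - If $I(\xi)<\frac k2$, then $\xi^+=\xi$, and this is the only design $\zeta$ satisfying $\int_A^B\Psi_i\,d\zeta=\int_A^B\Psi_i\,d\xi$ for $i=0,\dots,k-1$. - If $I(\xi)\ge\frac k2$ and $k$ is odd, then $\xi^+$ has at most $\frac{k+1}{2}$ support points, and its support contains $B$. - If $I(\xi)\ge\frac k2$ and $k$ is even, then $\xi^+$ has at most $\frac k2+1$ support points, and its support contains $A$ and $B$. (2) If $\{\Psi_0,\dots,\Psi_{k-1}\}$ and $\{\Psi_0,\dots,\Psi_{k-1},-\Psi_k\}$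 are Chebyshev systems, then for every design $\xi$ there is a design $\xi^-$ with at most $\frac{k+2}{2}$ support points such that $M(\xi^-,\theta)\ge M(\xi,\theta)$, and $\xi^-$ can be chosen such that the following holds. - If $I(\xi)<\frac k2$, then $\xi^-=\xi$, and this is the only design $\zeta$ satisfying $\int_A^B\Psi_i\,d\zeta=\int_A^B\Psi_i\,d\xi$ for $i=0,\dots,k-1$. - If $I(\xi)\ge\frac k2$ and $k$ is odd, then $\xi^-$ has at most $\frac{k+1}{2}$ support points, and its support contains $A$. - If $I(\xi)\ge\frac k2$ and $k$ is even, then $\xi^-$ has at most $\frac k2$ support points. -/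

import Mathlib

open MeasureTheory
open scoped Matrix MatrixOrder

noncomputable section

/-- A (approximate) design on `[A, B]`: a probability measure on `[A, B]` with finite support. -/
@[ext]
structure Design (A B : ℝ) where
  measure : Measure (Set.Icc A B)
  isProbabilityMeasure : IsProbabilityMeasure measure
  finite_support : measure.support.Finite

namespace Design

variable {A B : ℝ}

/-- The set of support points of a design, as a subset of the real line. -/
def supp (ξ : Design A B) : Set ℝ := (fun x : Set.Icc A B => (x : ℝ)) '' ξ.measure.support

/-- The index of a design: the number of its support points, where the boundary points
`A` and `B`, if they occur, are counted by `1 / 2` only. -/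
def index (ξ : Design A B) : ℝ :=
  ∑ᶠ x ∈ ξ.supp, if x = A ∨ x = B then (1 / 2 : ℝ) else 1

/-- The information matrix `∫ f(x) f(x)ᵀ dξ(x)`, where `f(x)` is the gradient of the
regression function with respect to the parameter. -/
def infoMatrix {p : ℕ} (f : Set.Icc A B → EuclideanSpace ℝ (Fin p)) (ξ : Design A B) :
    Matrix (Fin p) (Fin p) ℝ :=
  Matrix.of fun i j => ∫ x, f x i * f x j ∂ξ.measure

/-- The matrix with entries `∫ Ψ_{ij}(x) dξ(x)`. -/
def reducedMatrix {p : ℕ} (Ψ : Fin p → Fin p → Set.Icc A B → ℝ) (ξ : Design A B) :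
    Matrix (Fin p) (Fin p) ℝ :=
  Matrix.of fun i j => ∫ x, Ψ i j x ∂ξ.measure

/-- Two designs have the same integrals of all functions of the finite family `u`. -/
def SameMoments {m : ℕ} (u : Fin m → Set.Icc A B → ℝ) (η ξ : Design A B) : Prop :=
  ∀ i, ∫ x, u i x ∂η.measure = ∫ x, u i x ∂ξ.measure

end Design

/-- `u_0, …, u_{m-1}` is a Chebyshev system on `[A, B]`: the functions are continuous and
`det (u_i(x_j)) > 0` for all `A ≤ x_0 < ⋯ < x_{m-1} ≤ B`. -/
def IsChebyshevSystem {A B : ℝ} {m : ℕ} (u : Fin m → Set.Icc A B → ℝ) : Prop :=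
  (∀ i, Continuous (u i)) ∧
    ∀ x : Fin m → Set.Icc A B, StrictMono x → 0 < (Matrix.of fun i j => u i (x j)).det

/-- `ψ 0` is the constant function `1`, and `ψ 1, …, ψ k` list, without repetition, the
nonconstant functions among the entries `Ψ i j`. -/
structure IsEnumeration {A B : ℝ} {p k : ℕ} (Ψ : Fin p → Fin p → Set.Icc A B → ℝ)
    (ψ : Fin (k + 1) → Set.Icc A B → ℝ) : Prop where
  zero : ψ 0 = fun _ => 1
  injective : Function.Injective fun i : Fin k => ψ i.succ
  range_eq : (Set.range fun i : Fin k => ψ i.succ) =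
    {g | (∃ i j, g = Ψ i j) ∧ ¬ ∃ c : ℝ, g = fun _ => c}

/-- The function `g` occurs exactly once among the entries `Ψ i j`, and on the diagonal. -/
def OccursOnceOnDiagonal {A B : ℝ} {p : ℕ} (Ψ : Fin p → Fin p → Set.Icc A B → ℝ)
    (g : Set.Icc A B → ℝ) : Prop :=
  ∃ l, g = Ψ l l ∧ ∀ i j, (i, j) ≠ (l, l) → Ψ i j ≠ g

end

/-! A design is a finitely supported weight function, and a nonzero difference of two designs with
equal moments is a signed measure annihilating a Chebyshev system of `k` functions. Such a measure
has `k` sign changes (`exists_sign_changes`), so each of the two designs charges every other one of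
some `k + 1` ordered points and has index at least `k / 2`. Hence a design of smaller index is
determined by its moments.

For larger index, compactness gives a design maximizing `∫ ψ_k` under fixed lower moments. By (D)
only one diagonal entry of `C` changes, and it does not decrease, so the information matrix does not
decrease. The sign condition on the full determinant makes the alternating measure on any `k + 1`
ordered points, suitably signed, increase `∫ ψ_k`. At the maximizer this perturbation must be
infeasible, so the points where it is negative cannot all be support points. Interlacing turns this
into an upper bound on the support, even after certain endpoints are adjoined (`exists_extremal`).
The index, still at least `k / 2`, then forces those endpoints to be support points. -/

namespace Design

/-! ### Designs as finitely supported weights -/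

variable {A B : ℝ}

/-- The point masses of a design. -/
noncomputable def weights (ξ : Design A B) : Set.Icc A B →₀ ℝ :=
  Finsupp.onFinset ξ.finite_support.toFinset (fun x => ξ.measure.real {x}) fun x hx => by
    rw [Set.Finite.mem_toFinset]
    by_contra h
    exact hx (by
      have : ξ.measure {x} = 0 :=
        measure_mono_null (Set.singleton_subset_iff.2 h) Measure.measure_compl_support
      simp [Measure.real, this])

lemma weights_apply (ξ : Design A B) (x : Set.Icc A B) : ξ.weights x = ξ.measure.real {x} := rfl

lemma weights_nonneg (ξ : Design A B) (x : Set.Icc A B) : 0 ≤ ξ.weights x :=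
  measureReal_nonneg

lemma restrict_support (ξ : Design A B) :
    ξ.measure.restrict ξ.finite_support.toFinset = ξ.measure := by
  rw [Measure.restrict_eq_self_of_ae_mem]
  simpa using Measure.support_mem_ae (μ := ξ.measure)

lemma integral_eq (ξ : Design A B) (g : Set.Icc A B → ℝ) :
    ∫ x, g x ∂ξ.measure = Finsupp.linearCombination ℝ g ξ.weights := by
  have := ξ.isProbabilityMeasure
  rw [← restrict_support ξ, setIntegral_finset _ IntegrableOn.finset,
    Finsupp.linearCombination_apply, weights, Finsupp.onFinset_sum _ (by simp)]

/-- Deleting the other, finitely many support points leaves a neighbourhood of a support point, all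
of whose mass sits at that point. -/
lemma measure_singleton_pos_iff (ξ : Design A B) (x : Set.Icc A B) :
    0 < ξ.measure {x} ↔ x ∈ ξ.measure.support := by
  constructor
  · intro h
    by_contra hx
    exact h.ne' (measure_mono_null (Set.singleton_subset_iff.2 hx) Measure.measure_compl_support)
  · intro h
    rw [Measure.mem_support_iff_forall] at h
    have hfin : (ξ.measure.support \ {x}).Finite := ξ.finite_support.sdiff
    have := h _ (hfin.isClosed.isOpen_compl.mem_nhds (by simp))
    refine this.trans_le ?_
    calc ξ.measure (ξ.measure.support \ {x})ᶜ
        ≤ ξ.measure (ξ.measure.supportᶜ ∪ {x}) := measure_mono (by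
          intro y hy
          by_cases hyx : y = x
          · simp [hyx]
          · exact Or.inl fun h => hy ⟨h, hyx⟩)
      _ ≤ ξ.measure (ξ.measure.supportᶜ) + ξ.measure {x} := measure_union_le _ _
      _ = ξ.measure {x} := by rw [Measure.measure_compl_support, zero_add]

lemma mem_weights_support (ξ : Design A B) (x : Set.Icc A B) :
    x ∈ ξ.weights.support ↔ x ∈ ξ.measure.support := by
  have := ξ.isProbabilityMeasure
  rw [← measure_singleton_pos_iff, Finsupp.mem_support_iff, weights_apply, pos_iff_ne_zero,
    ne_eq, measureReal_eq_zero_iff]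

lemma supp_eq (ξ : Design A B) :
    ξ.supp = (ξ.weights.support.map (Function.Embedding.subtype _) : Finset ℝ) := by
  ext x
  simp only [supp, Finset.coe_map, Set.mem_image, Finset.mem_coe, mem_weights_support]
  rfl

lemma ncard_supp (ξ : Design A B) : ξ.supp.ncard = ξ.weights.support.card := by
  rw [supp_eq, Set.ncard_coe_finset, Finset.card_map]

lemma index_eq (ξ : Design A B) :
    ξ.index = ∑ x ∈ ξ.weights.support, if (x : ℝ) = A ∨ (x : ℝ) = B then (1 / 2 : ℝ) else 1 := by
  rw [index, supp_eq, finsum_mem_coe_finset, Finset.sum_map]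
  rfl

lemma measure_eq_sum (ξ : Design A B) :
    ξ.measure = ∑ x ∈ ξ.weights.support, ENNReal.ofReal (ξ.weights x) • Measure.dirac x := by
  classical
  have := ξ.isProbabilityMeasure
  ext s hs
  have h1 : ξ.measure s = ξ.measure (ξ.weights.support.filter (· ∈ s)) := by
    refine measure_congr ?_
    filter_upwards [Measure.support_mem_ae (μ := ξ.measure)] with x hx
    refine propext ?_
    change x ∈ s ↔ x ∈ ((ξ.weights.support.filter (· ∈ s) : Finset _) : Set _)
    rw [Finset.mem_coe, Finset.mem_filter, mem_weights_support]
    exact ⟨fun h => ⟨hx, h⟩, fun h => h.2⟩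
  rw [h1, ← sum_measure_singleton, Finset.sum_filter, Measure.finsetSum_apply]
  refine Finset.sum_congr rfl fun x _ => ?_
  by_cases hx : x ∈ s
  · simp [hx, weights_apply, hs]
  · simp [hx, hs]

lemma ext_weights {ξ η : Design A B} (h : ξ.weights = η.weights) : ξ = η := by
  ext1
  rw [measure_eq_sum ξ, measure_eq_sum η, h]

lemma exists_weights_eq (w : Set.Icc A B →₀ ℝ) (h0 : ∀ x, 0 ≤ w x)
    (h1 : Finsupp.linearCombination ℝ (fun _ => (1 : ℝ)) w = 1) :
    ∃ ξ : Design A B, ξ.weights = w := by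
  set μ : Measure (Set.Icc A B) :=
    ∑ x ∈ w.support, ENNReal.ofReal (w x) • Measure.dirac x with hμ
  have hμs : ∀ s, MeasurableSet s → μ s = ∑ x ∈ w.support, ENNReal.ofReal (w x) * s.indicator 1 x :=
    fun s hs => by simp [hμ, Measure.finsetSum_apply, hs]
  have hprob : IsProbabilityMeasure μ := ⟨by
    rw [hμs _ MeasurableSet.univ]
    simp only [Set.indicator_univ, Pi.one_apply, mul_one]
    rw [← ENNReal.ofReal_sum_of_nonneg fun x _ => h0 x]
    rw [Finsupp.linearCombination_apply, Finsupp.sum] at h1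
    simp only [smul_eq_mul, mul_one] at h1
    rw [h1, ENNReal.ofReal_one]⟩
  have hsupp : μ.support ⊆ w.support := by
    refine Measure.support_subset_of_isClosed w.support.finite_toSet.isClosed ?_
    rw [mem_ae_iff, hμs _ w.support.measurableSet.compl]
    refine Finset.sum_eq_zero fun x hx => ?_
    rw [Set.indicator_of_notMem (by simpa using hx), mul_zero]
  refine ⟨⟨μ, hprob, w.support.finite_toSet.subset hsupp⟩, ?_⟩
  ext x
  rw [weights_apply, Measure.real, hμs _ (measurableSet_singleton x), Finset.sum_eq_single x]
  · simp [h0 x]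
  · intro y _ hy
    simp [hy]
  · intro hx
    simp [Finsupp.notMem_support_iff.1 hx]

end Design

/-! ### Compactness and existence of a maximizer -/

/-- The convex hull of a compact set in a finite-dimensional space is compact. -/
lemma IsCompact.isCompact_convexHull_of_finiteDimensional {E : Type*} [NormedAddCommGroup E]
    [NormedSpace ℝ E] [FiniteDimensional ℝ E] {s : Set E} (hs : IsCompact s) :
    IsCompact (convexHull ℝ s) := by
  rcases s.eq_empty_or_nonempty with rfl | ⟨x₀, hx₀⟩
  · simp
  -- By Carathéodory `N` points suffice, so the hull is a continuous image of the compact set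
  -- simplex × `s ^ N`.
  set N := Module.finrank ℝ E + 1
  have hK : IsCompact ((stdSimplex ℝ (Fin N)) ×ˢ (Set.univ.pi fun _ : Fin N => s)) :=
    (isCompact_stdSimplex ℝ (Fin N)).prod (isCompact_univ_pi fun _ => hs)
  have hc : Continuous fun q : (Fin N → ℝ) × (Fin N → E) => ∑ i, q.1 i • q.2 i := by fun_prop
  convert hK.image hc
  ext x
  constructor
  · intro hx
    obtain ⟨ι, _, z, w, hz, hind, hw, hw1, hx⟩ := eq_pos_convex_span_of_mem_convexHull hx
    have hcard : Fintype.card ι ≤ Fintype.card (Fin N) := by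
      rw [Fintype.card_fin]
      exact hind.card_le_finrank_succ.trans (Nat.succ_le_succ (Submodule.finrank_le _))
    obtain ⟨e⟩ := Function.Embedding.nonempty_of_card_le hcard
    -- Unused slots get weight zero and the dummy point `x₀`.
    refine ⟨(Function.extend e w 0, Function.extend e z fun _ => x₀), ⟨⟨fun j => ?_, ?_⟩, ?_⟩, ?_⟩
    · by_cases hj : j ∈ Set.range e
      · obtain ⟨i, rfl⟩ := hj
        simpa [e.injective.extend_apply] using (hw i).le
      · simp [Function.extend_apply' _ _ _ hj]
    · rw [← hw1]
      refine (Fintype.sum_of_injective e e.injective _ _ (fun j hj => ?_) fun i => ?_).symm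
      · exact Function.extend_apply' _ _ _ hj
      · exact (e.injective.extend_apply _ _ _).symm
    · intro j _
      by_cases hj : j ∈ Set.range e
      · obtain ⟨i, rfl⟩ := hj
        simpa [e.injective.extend_apply] using hz ⟨i, rfl⟩
      · simpa [Function.extend_apply' _ _ _ hj] using hx₀
    · rw [← hx]
      refine (Fintype.sum_of_injective e e.injective _ _ (fun j hj => ?_) fun i => ?_).symm
      · simp [Function.extend_apply' _ _ _ hj]
      · simp [e.injective.extend_apply]
  · rintro ⟨⟨w, z⟩, ⟨⟨hw, hw1⟩, hz⟩, rfl⟩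
    exact mem_convexHull_iff_exists_fintype.2
      ⟨Fin N, inferInstance, w, z, hw, hw1, fun i => hz i trivial, rfl⟩

/-- The convex hull of the range of `v` consists of the convex combinations of values of `v`. -/
lemma exists_finsupp_of_mem_convexHull_range {X E : Type*} [AddCommGroup E] [Module ℝ E]
    {v : X → E} {z : E} (hz : z ∈ convexHull ℝ (Set.range v)) :
    ∃ w : X →₀ ℝ, (∀ x, 0 ≤ w x) ∧ Finsupp.linearCombination ℝ (fun _ => (1 : ℝ)) w = 1 ∧
      Finsupp.linearCombination ℝ v w = z := by
  obtain ⟨ι, _, a, b, ha, ha1, hb, rfl⟩ := mem_convexHull_iff_exists_fintype.1 hz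
  choose y hy using hb
  refine ⟨∑ i, Finsupp.single (y i) (a i), fun x => ?_, ?_, ?_⟩
  · rw [Finsupp.finsetSum_apply]
    classical
    refine Finset.sum_nonneg fun i _ => ?_
    rw [Finsupp.single_apply]
    split_ifs
    exacts [ha i, le_rfl]
  · simp [map_sum, ha1]
  · simp [map_sum, hy]

lemma linearCombination_mem_convexHull_range {X E : Type*} [AddCommGroup E] [Module ℝ E]
    (v : X → E) {w : X →₀ ℝ} (hw : ∀ x, 0 ≤ w x)
    (hw1 : Finsupp.linearCombination ℝ (fun _ => (1 : ℝ)) w = 1) :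
    Finsupp.linearCombination ℝ v w ∈ convexHull ℝ (Set.range v) := by
  rw [Finsupp.linearCombination_apply, Finsupp.sum] at *
  refine (convex_convexHull ℝ _).sum_mem (fun x _ => hw x) (by simpa using hw1) fun x _ =>
    subset_convexHull ℝ _ ⟨x, rfl⟩

/-- Among the convex combinations with prescribed moments `∫ u i`, one maximizes `∫ g`. -/
lemma exists_maximal_weights {X : Type*} [TopologicalSpace X] [CompactSpace X] {k : ℕ}
    {u : Fin k → X → ℝ} {g : X → ℝ} (hu : ∀ i, Continuous (u i)) (hg : Continuous g)
    {w₀ : X →₀ ℝ} (h0 : ∀ x, 0 ≤ w₀ x)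
    (h1 : Finsupp.linearCombination ℝ (fun _ => (1 : ℝ)) w₀ = 1) :
    ∃ w : X →₀ ℝ, (∀ x, 0 ≤ w x) ∧ Finsupp.linearCombination ℝ (fun _ => (1 : ℝ)) w = 1 ∧
      (∀ i, Finsupp.linearCombination ℝ (u i) w = Finsupp.linearCombination ℝ (u i) w₀) ∧
      ∀ v : X →₀ ℝ, (∀ x, 0 ≤ v x) → Finsupp.linearCombination ℝ (fun _ => (1 : ℝ)) v = 1 →
        (∀ i, Finsupp.linearCombination ℝ (u i) v = Finsupp.linearCombination ℝ (u i) w₀) →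
        Finsupp.linearCombination ℝ g v ≤ Finsupp.linearCombination ℝ g w := by
  set Φ : X → (Fin k → ℝ) × ℝ := fun x => (fun i => u i x, g x) with hΦ
  have hfst : ∀ (v : X →₀ ℝ) i, (Finsupp.linearCombination ℝ Φ v).1 i =
      Finsupp.linearCombination ℝ (u i) v := fun v i => by
    simp [Finsupp.linearCombination_apply, Finsupp.sum, Prod.fst_sum, hΦ]
  have hsnd : ∀ (v : X →₀ ℝ), (Finsupp.linearCombination ℝ Φ v).2 =
      Finsupp.linearCombination ℝ g v := fun v => by
    simp [Finsupp.linearCombination_apply, Finsupp.sum, Prod.snd_sum, hΦ]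
  have hΦc : Continuous Φ := by fun_prop
  -- The attainable moment vectors form the hull of the curve `Φ`; fixing the first `k` moments cuts
  -- out a compact slice.
  set K := convexHull ℝ (Set.range Φ) ∩
    {z | ∀ i, z.1 i = Finsupp.linearCombination ℝ (u i) w₀} with hK
  have hKc : IsCompact K := by
    refine (isCompact_range hΦc).isCompact_convexHull_of_finiteDimensional.inter_right ?_
    simp only [Set.ofPred_forall]
    exact isClosed_iInter fun i => isClosed_eq (by fun_prop) continuous_const
  have hmem : ∀ v : X →₀ ℝ, (∀ x, 0 ≤ v x) →
      Finsupp.linearCombination ℝ (fun _ => (1 : ℝ)) v = 1 →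
      (∀ i, Finsupp.linearCombination ℝ (u i) v = Finsupp.linearCombination ℝ (u i) w₀) →
      Finsupp.linearCombination ℝ Φ v ∈ K := fun v hv hv1 hvu =>
    ⟨linearCombination_mem_convexHull_range Φ hv hv1, fun i => by rw [hfst, hvu]⟩
  obtain ⟨z, hz, hmax⟩ := hKc.exists_isMaxOn ⟨_, hmem w₀ h0 h1 fun _ => rfl⟩
    (f := Prod.snd) continuous_snd.continuousOn
  obtain ⟨w, hw, hw1, rfl⟩ := exists_finsupp_of_mem_convexHull_range hz.1
  refine ⟨w, hw, hw1, fun i => by rw [← hfst]; exact hz.2 i, fun v hv hv1 hvu => ?_⟩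
  rw [← hsnd, ← hsnd]
  exact hmax (hmem v hv hv1 hvu)

/-! ### Sign changes of annihilating measures -/

namespace IsChebyshevSystem

variable {A B : ℝ} {k : ℕ} {u : Fin k → Set.Icc A B → ℝ}

/-- On `k + 1` ordered points there are weights of alternating signs that annihilate a Chebyshev
system of `k` functions; they integrate any further function to a determinant. -/
lemma exists_alternating (hu : IsChebyshevSystem u) {y : Fin (k + 1) → Set.Icc A B}
    (hy : StrictMono y) :
    ∃ τ : Set.Icc A B →₀ ℝ, (∀ j : Fin (k + 1), 0 < (-1) ^ (k + j : ℕ) * τ (y j)) ∧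
      (∀ x, τ x ≠ 0 → x ∈ Set.range y) ∧
      (∀ i, Finsupp.linearCombination ℝ (u i) τ = 0) ∧
      ∀ g : Set.Icc A B → ℝ, Finsupp.linearCombination ℝ g τ =
        (Matrix.of fun i j => (Fin.snoc u g : Fin (k + 1) → Set.Icc A B → ℝ) i (y j)).det := by
  -- The weights are the cofactors along the last row of the bordered matrix; the minors are
  -- positive, so the signs alternate.
  set σ : Fin (k + 1) → ℝ := fun j =>
    (-1) ^ (k + j : ℕ) * (Matrix.of fun i j' => u i (y (j.succAbove j'))).det with hσ
  set τ := Finsupp.embDomain ⟨y, hy.injective⟩ ((Finsupp.linearEquivFunOnFinite ℝ ℝ _).symm σ)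
    with hτ
  have hτy : ∀ j, τ (y j) = σ j := fun j =>
    Finsupp.embDomain_apply_self ⟨y, hy.injective⟩ _ j
  have hdet : ∀ g : Set.Icc A B → ℝ, Finsupp.linearCombination ℝ g τ =
      (Matrix.of fun i j => (Fin.snoc u g : Fin (k + 1) → Set.Icc A B → ℝ) i (y j)).det := by
    intro g
    rw [hτ, Finsupp.linearCombination_embDomain,
      Finsupp.linearCombination_eq_fintype_linearCombination_apply,
      Fintype.linearCombination_apply, Matrix.det_succ_row _ (Fin.last k)]
    refine Finset.sum_congr rfl fun j _ => ?_
    have : (Matrix.of fun i j => (Fin.snoc u g : Fin (k + 1) → Set.Icc A B → ℝ) i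
        (y j)).submatrix (Fin.last k).succAbove j.succAbove =
        Matrix.of fun i j' => u i (y (j.succAbove j')) := by
      ext i j'
      simp
    rw [this]
    simp [hσ]
    ring
  refine ⟨τ, fun j => ?_, fun x hx => ?_, fun i => ?_, hdet⟩
  · rw [hτy, hσ, ← mul_assoc, ← pow_add, Even.neg_one_pow ⟨_, rfl⟩, one_mul]
    exact hu.2 _ (hy.comp (Fin.strictMono_succAbove j))
  · by_contra h
    exact hx (Finsupp.embDomain_of_notMem_range _ _ _ h)
  · rw [hdet]
    refine Matrix.det_zero_of_row_eq (i := i.castSucc) (j := Fin.last k) (Fin.castSucc_ne_last i) ?_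
    ext j
    simp

/-- A nonzero discrete signed measure that annihilates a Chebyshev system of `k` functions
charges at least `k + 1` points. -/
lemma lt_card_support (hAB : A < B) (hu : IsChebyshevSystem u) {σ : Set.Icc A B →₀ ℝ}
    (hσ : σ ≠ 0) (h : ∀ i, Finsupp.linearCombination ℝ (u i) σ = 0) : k < σ.support.card := by
  by_contra! hcard
  -- Pad the support to exactly `k` points, where the system has an invertible matrix.
  have : Infinite (Set.Icc A B) := (Set.Icc_infinite hAB).to_subtype
  obtain ⟨T, hT, hTk⟩ := Infinite.exists_superset_card_eq _ _ hcard
  have hdet := hu.2 _ (T.orderEmbOfFin hTk).strictMono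
  have hsum : ∀ F : Set.Icc A B → ℝ, ∑ x ∈ T, F x = ∑ j, F (T.orderEmbOfFin hTk j) := fun F => by
    conv_lhs => rw [← Finset.map_orderEmbOfFin_univ T hTk, Finset.sum_map]
    rfl
  have hzero : (fun j => σ (T.orderEmbOfFin hTk j)) = 0 := by
    refine Matrix.eq_zero_of_mulVec_eq_zero hdet.ne' ?_
    ext i
    rw [Pi.zero_apply, ← h i, Finsupp.linearCombination_apply,
      Finsupp.sum_of_support_subset σ hT _ (by simp),
      hsum]
    simp [Matrix.mulVec, dotProduct, mul_comm]
  refine hσ (Finsupp.ext fun x => ?_)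
  by_cases hx : x ∈ T
  · have : x ∈ Set.range (T.orderEmbOfFin hTk) := by rwa [Finset.range_orderEmbOfFin]
    obtain ⟨j, rfl⟩ := this
    exact congrFun hzero j
  · exact Finsupp.notMem_support_iff.1 fun h => hx (hT h)

/-- A nonzero discrete signed measure that annihilates a Chebyshev system of `k` functions has
`k` sign changes. -/
lemma exists_sign_changes (hAB : A < B) (hu : IsChebyshevSystem u) {σ : Set.Icc A B →₀ ℝ}
    (hσ : σ ≠ 0) (h : ∀ i, Finsupp.linearCombination ℝ (u i) σ = 0) :
    ∃ (y : Fin (k + 1) → Set.Icc A B) (s : ℕ), StrictMono y ∧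
      ∀ j : Fin (k + 1), 0 < (-1) ^ (j + s : ℕ) * σ (y j) := by
  induction hN : σ.support.card using Nat.strong_induction_on generalizing σ with
  | _ N ih =>
  subst hN
  have hlt := hu.lt_card_support hAB hσ h
  set y := σ.support.orderEmbOfCardLe (Nat.succ_le_of_lt hlt) with hydef
  have hyσ : ∀ j, σ (y j) ≠ 0 := fun j =>
    Finsupp.mem_support_iff.1 (Finset.orderEmbOfCardLe_mem _ _ j)
  obtain ⟨τ, hτ, hτy, hτu, -⟩ := hu.exists_alternating y.strictMono
  have hτ0 : ∀ j, τ (y j) ≠ 0 := fun j h0 => by simpa [h0] using hτ j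
  obtain ⟨j₀, -, hj₀⟩ := Finset.exists_min_image Finset.univ
    (fun j => |σ (y j)| / |τ (y j)|) Finset.univ_nonempty
  -- Minimality of the ratio gives `|t * τ| ≤ |σ|` everywhere, while `σ - t • τ` vanishes at `y j₀`:
  -- the support shrinks.
  set t := σ (y j₀) / τ (y j₀) with ht
  have ht0 : t ≠ 0 := div_ne_zero (hyσ _) (hτ0 _)
  have hle : ∀ x, |t * τ x| ≤ |σ x| := by
    intro x
    by_cases hx : τ x = 0
    · simp [hx]
    · obtain ⟨j, rfl⟩ := hτy x hx
      rw [abs_mul, ← le_div_iff₀ (abs_pos.2 hx), ht, abs_div]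
      exact hj₀ j (Finset.mem_univ _)
  set σ' := σ - t • τ with hσ'
  have hσ'x : ∀ x, σ' x = σ x - t * τ x := fun x => by simp [hσ']
  have hsub : σ'.support ⊆ σ.support := by
    intro x hx
    rw [Finsupp.mem_support_iff] at hx ⊢
    intro h0
    have := hle x
    rw [h0, abs_zero, abs_nonpos_iff] at this
    exact hx (by rw [hσ'x, h0, this, sub_zero])
  have hss : σ'.support ⊂ σ.support := by
    refine (Finset.ssubset_iff_of_subset hsub).2 ⟨y j₀, by simpa using hyσ j₀, ?_⟩
    rw [Finsupp.notMem_support_iff, hσ'x, ht, div_mul_cancel₀ _ (hτ0 _), sub_self]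
  by_cases h0 : σ' = 0
  · have hσx : ∀ x, σ x = t * τ x := fun x => by
      have := hσ'x x
      rw [h0, Finsupp.zero_apply] at this
      linarith
    rcases ht0.lt_or_gt with hneg | hpos
    · refine ⟨y, k + 1, y.strictMono, fun j => ?_⟩
      rw [hσx, show (j + (k + 1) : ℕ) = k + j + 1 by ring, pow_succ]
      nlinarith [hτ j]
    · refine ⟨y, k, y.strictMono, fun j => ?_⟩
      rw [hσx, show (j + k : ℕ) = k + j by ring]
      nlinarith [hτ j]
  · obtain ⟨z, s, hz, hzs⟩ := ih _ (Finset.card_lt_card hss) h0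
      (fun i => by rw [hσ', map_sub, map_smul, h, hτu, smul_zero, sub_zero]) rfl
    refine ⟨z, s, hz, fun j => ?_⟩
    have h1 := hzs j
    have h2 := abs_le.1 (hle (z j))
    rw [hσ'x] at h1
    -- Since `|t * τ| ≤ |σ|`, a nonzero value of `σ - t * τ` has the sign of `σ`.
    rcases neg_one_pow_eq_or ℝ (j + s) with h3 | h3 <;> rw [h3] at h1 ⊢
    · by_contra! h4
      rw [abs_of_nonpos (by linarith)] at h2
      linarith
    · by_contra! h4
      rw [abs_of_nonneg (by linarith)] at h2
      linarith

end IsChebyshevSystem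

/-! ### The index and uniqueness for small index -/

lemma sum_range_even_indicator (s k : ℕ) :
    ∑ j ∈ Finset.range (k + 1), (if Even (j + s) then (1 : ℝ) else 0) =
      (k + (if Even s then 1 else 0) + if Even (k + s) then 1 else 0) / 2 := by
  induction k with
  | zero =>
    rw [Finset.sum_range_one]
    by_cases hs : Even s <;> simp [hs]
  | succ k ih =>
    rw [Finset.sum_range_succ, ih]
    by_cases hs : Even s <;> by_cases hk : Even k <;>
      simp [hs, hk, Nat.even_add_one, Nat.even_add] <;> ring

namespace Design

variable {A B : ℝ} {k : ℕ}

lemma index_eq_card_sub (hAB : A < B) (ξ : Design A B) :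
    ξ.index = ξ.weights.support.card
      - (if (⟨A, Set.left_mem_Icc.2 hAB.le⟩ : Set.Icc A B) ∈ ξ.weights.support then 1 / 2 else 0)
      - (if (⟨B, Set.right_mem_Icc.2 hAB.le⟩ : Set.Icc A B) ∈ ξ.weights.support
          then 1 / 2 else 0) := by
  rw [index_eq, ← Finset.sum_ite_eq' ξ.weights.support _ fun _ => (1 / 2 : ℝ),
    ← Finset.sum_ite_eq' ξ.weights.support (⟨B, _⟩ : Set.Icc A B) fun _ => (1 / 2 : ℝ),
    Finset.card_eq_sum_ones, Nat.cast_sum, ← Finset.sum_sub_distrib, ← Finset.sum_sub_distrib]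
  refine Finset.sum_congr rfl fun x _ => ?_
  simp only [Subtype.ext_iff]
  by_cases h1 : (x : ℝ) = A
  · simp [h1, hAB.ne]
    norm_num
  · by_cases h2 : (x : ℝ) = B
    · simp [h2, hAB.ne']
      norm_num
    · simp [h1, h2]

/-- A design that charges every other one of `k + 1` ordered points has index at least `k / 2`. -/
lemma le_index_of_alternate (ξ : Design A B) {y : Fin (k + 1) → Set.Icc A B} (hy : StrictMono y)
    (s : ℕ) (h : ∀ j : Fin (k + 1), Even (j + s : ℕ) → ξ.weights (y j) ≠ 0) :
    (k : ℝ) / 2 ≤ ξ.index := by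
  set c : Set.Icc A B → ℝ := fun x => if (x : ℝ) = A ∨ (x : ℝ) = B then (1 / 2 : ℝ) else 1 with hc
  have hc0 : ∀ x, 0 ≤ c x := fun x => by
    simp only [hc]
    split_ifs <;> norm_num
  -- Only `y 0` can be `A` and only `y k` can be `B`, so only these may count one half.
  have hpt : ∀ j : Fin (k + 1), 1 - (if (j : ℕ) = 0 then (1 / 2 : ℝ) else 0)
      - (if (j : ℕ) = k then (1 / 2 : ℝ) else 0) ≤ c (y j) := by
    intro j
    have hA : (j : ℕ) ≠ 0 → (y j : ℝ) ≠ A := fun hj hA => by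
      have : y 0 < y j := hy (Fin.pos_iff_ne_zero.2 fun h => hj (by simp [h]))
      have h2 : (y 0 : ℝ) < y j := this
      linarith [(y 0).2.1]
    have hB : (j : ℕ) ≠ k → (y j : ℝ) ≠ B := fun hj hB => by
      have : y j < y (Fin.last k) := hy (Fin.lt_last_iff_ne_last.2 fun h => hj (by simp [h]))
      have h2 : (y j : ℝ) < y (Fin.last k) := this
      linarith [(y (Fin.last k)).2.2]
    simp only [hc]
    by_cases h1 : (j : ℕ) = 0 <;> by_cases h2 : (j : ℕ) = k
    · rw [if_pos h1, if_pos h2]; split_ifs <;> norm_num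
    · rw [if_pos h1, if_neg h2]; split_ifs <;> norm_num
    · rw [if_neg h1, if_pos h2]; split_ifs <;> norm_num
    · rw [if_neg h1, if_neg h2, if_neg (by simp [hA h1, hB h2])]; norm_num
  set J : Finset (Fin (k + 1)) := Finset.univ.filter fun j => Even (j + s : ℕ) with hJ
  have h1 : ∑ j ∈ J, c (y j) ≤ ξ.index := by
    rw [index_eq, ← Finset.sum_image (f := c) (fun a _ b _ hab => hy.injective hab)]
    refine Finset.sum_le_sum_of_subset_of_nonneg (fun x hx => ?_) fun x _ _ => hc0 x
    obtain ⟨j, hj, rfl⟩ := Finset.mem_image.1 hx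
    exact Finsupp.mem_support_iff.2 (h j (Finset.mem_filter.1 hj).2)
  refine le_trans ?_ ((Finset.sum_le_sum fun j _ => hpt j).trans h1)
  rw [hJ, Finset.sum_filter]
  have h2 : ∑ j : Fin (k + 1), (if Even (j + s : ℕ) then 1 - (if (j : ℕ) = 0 then (1 / 2 : ℝ) else 0)
      - (if (j : ℕ) = k then (1 / 2 : ℝ) else 0) else 0) =
      ∑ j ∈ Finset.range (k + 1), ((if Even (j + s) then (1 : ℝ) else 0)
        - (if j = 0 then (if Even (j + s) then (1 / 2 : ℝ) else 0) else 0)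
        - (if j = k then (if Even (j + s) then (1 / 2 : ℝ) else 0) else 0)) := by
    rw [Finset.sum_range]
    refine Finset.sum_congr rfl fun j _ => ?_
    split_ifs <;> norm_num
  -- The excess of the count over `k / 2` is one half for each selected end, so the sum is exactly
  -- `k / 2`.
  rw [h2, Finset.sum_sub_distrib, Finset.sum_sub_distrib, sum_range_even_indicator,
    Finset.sum_ite_eq', Finset.sum_ite_eq']
  simp only [Finset.mem_range, Nat.succ_pos, if_true, Nat.lt_succ_self, zero_add]
  split_ifs <;> linarith

/-- A design of index less than `k / 2` is determined by its moments with respect to a Chebyshev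
system of `k` functions. -/
lemma eq_of_sameMoments (hAB : A < B) {u : Fin k → Set.Icc A B → ℝ} (hu : IsChebyshevSystem u)
    {ξ η : Design A B} (hξ : ξ.index < (k : ℝ) / 2) (h : SameMoments u η ξ) : η = ξ := by
  by_contra hne
  have hσ : η.weights - ξ.weights ≠ 0 := fun h0 => hne (ext_weights (sub_eq_zero.1 h0))
  obtain ⟨y, s, hy, hs⟩ := hu.exists_sign_changes hAB hσ fun i => by
    rw [map_sub, ← integral_eq, ← integral_eq, h i, sub_self]
  -- The shift `s + 1` selects the points where `η - ξ` is negative; there `ξ` must have mass.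
  refine hξ.not_ge (ξ.le_index_of_alternate hy (s + 1) fun j hj h0 => ?_)
  have h1 := hs j
  rw [Odd.neg_one_pow (by rwa [← add_assoc, Nat.even_add_one, Nat.not_even_iff_odd] at hj),
    Finsupp.sub_apply, h0] at h1
  linarith [η.weights_nonneg (y j)]

end Design

/-! ### Interlacing and extremal designs -/

/-- More than `(k + s + 1) / 2` points, of which `A` and `B` may have been added, can be interlaced
by further points to an ordered sequence of `k + 1` points. -/
lemma exists_interlacing {A B : ℝ} {k s : ℕ} {p : Set.Icc A B → Prop} (T : Finset (Set.Icc A B))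
    (hT : ∀ x ∈ T, p x ∨ (0 < s ∧ (x : ℝ) = A) ∨ (Odd (k + s) ∧ (x : ℝ) = B))
    (hcard : (k + s + 1) / 2 < T.card) :
    ∃ y : Fin (k + 1) → Set.Icc A B, StrictMono y ∧ ∀ j : Fin (k + 1), Even (j + s : ℕ) → p (y j) := by
  set z := T.orderEmbOfCardLe (Nat.succ_le_of_lt hcard) with hz
  have hzT : ∀ i, z i ∈ T := fun i => Finset.orderEmbOfCardLe_mem _ _ i
  have hzlt : ∀ i j : Fin ((k + s + 1) / 2).succ, (i : ℕ) < j → (z i : ℝ) < z j := fun i j hij =>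
    z.strictMono hij
  have hzle : ∀ i j : Fin ((k + s + 1) / 2).succ, (i : ℕ) ≤ j → (z i : ℝ) ≤ z j := fun i j hij =>
    z.monotone hij
  -- The point `y j` is the midpoint of `z (l j)` and `z (r j)`: a point of `T` when `j + s` is
  -- even, strictly between two neighbours otherwise.
  let l : Fin (k + 1) → Fin ((k + s + 1) / 2).succ := fun j => ⟨(j + s) / 2, by omega⟩
  let r : Fin (k + 1) → Fin ((k + s + 1) / 2).succ := fun j => ⟨(j + s + 1) / 2, by omega⟩
  have hmid : ∀ j, ((z (l j) : ℝ) + z (r j)) / 2 ∈ Set.Icc A B := fun j =>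
    ⟨by linarith [(z (l j)).2.1, (z (r j)).2.1], by linarith [(z (l j)).2.2, (z (r j)).2.2]⟩
  refine ⟨fun j => ⟨_, hmid j⟩, fun i j hij => ?_, fun j hj => ?_⟩
  · have hij' : (i : ℕ) < j := hij
    change ((z (l i) : ℝ) + z (r i)) / 2 < ((z (l j) : ℝ) + z (r j)) / 2
    have h1 := hzle (l i) (l j) (by simp only [l]; omega)
    have h2 := hzle (r i) (r j) (by simp only [r]; omega)
    rcases Nat.even_or_odd (i + s : ℕ) with ⟨m, hm⟩ | ⟨m, hm⟩
    · have h3 := hzlt (r i) (r j) (by simp only [r]; omega)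
      linarith
    · have h3 := hzlt (l i) (l j) (by simp only [l]; omega)
      linarith
  · obtain ⟨m, hm⟩ := hj
    have hlr : r j = l j := Fin.ext (by simp only [l, r]; omega)
    have hy : (⟨_, hmid j⟩ : Set.Icc A B) = z (l j) := Subtype.ext (by
      change ((z (l j) : ℝ) + z (r j)) / 2 = z (l j)
      rw [hlr]; ring)
    change p ⟨_, hmid j⟩
    rw [hy]
    -- If `s > 0`, even `j + s` skips `z 0`; if `k + s` is odd, it stops before the last `z`. An
    -- adjoined endpoint is therefore never selected.
    rcases hT _ (hzT (l j)) with h | ⟨hs, h⟩ | ⟨hs, h⟩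
    · exact h
    · have := hzlt 0 (l j) (by simp only [l, Fin.val_zero]; omega)
      linarith [(z 0).2.1]
    · obtain ⟨q, hq⟩ := hs
      have := hzlt (l j) (Fin.last _) (by simp only [l, Fin.val_last]; omega)
      linarith [(z (Fin.last _)).2.2]

namespace Design

variable {A B : ℝ} {k : ℕ}

/-- If every `k + 1` ordered points carry a signed measure that annihilates the functions `u i`,
integrates `g` to a positive number, and is negative at most at every other point, then a design
maximizing `∫ g` among those with the same moments has few support points. -/
lemma exists_extremal {u : Fin k → Set.Icc A B → ℝ} {g : Set.Icc A B → ℝ} {s : ℕ}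
    (hu : ∀ i, Continuous (u i)) (hg : Continuous g) (hone : ∃ i, u i = fun _ => 1)
    (hpert : ∀ y : Fin (k + 1) → Set.Icc A B, StrictMono y → ∃ τ : Set.Icc A B →₀ ℝ,
      (∀ i, Finsupp.linearCombination ℝ (u i) τ = 0) ∧ 0 < Finsupp.linearCombination ℝ g τ ∧
      ∀ x, τ x < 0 → ∃ j : Fin (k + 1), y j = x ∧ Even (j + s : ℕ))
    (ξ : Design A B) :
    ∃ η : Design A B, SameMoments u η ξ ∧ ∫ x, g x ∂ξ.measure ≤ ∫ x, g x ∂η.measure ∧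
      ∀ T : Finset (Set.Icc A B),
        (∀ x ∈ T, η.weights x ≠ 0 ∨ (0 < s ∧ (x : ℝ) = A) ∨ (Odd (k + s) ∧ (x : ℝ) = B)) →
        T.card ≤ (k + s + 1) / 2 := by
  have := ξ.isProbabilityMeasure
  have hξ1 : Finsupp.linearCombination ℝ (fun _ => (1 : ℝ)) ξ.weights = 1 := by
    rw [← integral_eq]
    simp
  obtain ⟨w, hw0, hw1, hwu, hmax⟩ := exists_maximal_weights hu hg ξ.weights_nonneg hξ1
  obtain ⟨η, rfl⟩ := exists_weights_eq w hw0 hw1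
  refine ⟨η, fun i => by rw [integral_eq, integral_eq, hwu], ?_, fun T hT => ?_⟩
  · rw [integral_eq, integral_eq]
    exact hmax _ ξ.weights_nonneg hξ1 fun _ => rfl
  by_contra! hcard
  obtain ⟨y, hy, hyη⟩ := exists_interlacing T hT hcard
  obtain ⟨τ, hτu, hτg, hτ⟩ := hpert y hy
  -- Where `τ` is negative `η` has mass, so a small multiple of `τ` can be added; this raises `∫ g`
  -- and contradicts maximality.
  have hev : ∀ᶠ ε in nhdsWithin (0 : ℝ) (Set.Ioi 0), ∀ x ∈ τ.support, 0 ≤ η.weights x + ε * τ x := by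
    rw [Filter.eventually_all_finset]
    intro x _
    by_cases hx : τ x < 0
    · obtain ⟨j, rfl, hj⟩ := hτ x hx
      have hpos : 0 < η.weights (y j) := (hw0 _).lt_of_ne' (hyη j hj)
      have hcont : Filter.Tendsto (fun ε : ℝ => η.weights (y j) + ε * τ (y j)) (nhds 0)
          (nhds (η.weights (y j) + 0 * τ (y j))) := Continuous.tendsto (by fun_prop) 0
      rw [zero_mul, add_zero] at hcont
      exact ((hcont.eventually (lt_mem_nhds hpos)).filter_mono nhdsWithin_le_nhds).mono
        fun _ h => h.le
    · filter_upwards [self_mem_nhdsWithin] with ε hε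
      exact add_nonneg (hw0 x) (mul_nonneg (le_of_lt hε) (not_lt.1 hx))
  obtain ⟨ε, hε, hε0 : 0 < ε⟩ := (hev.and self_mem_nhdsWithin).exists
  obtain ⟨i₀, hi₀⟩ := hone
  have hlc : ∀ v : Set.Icc A B → ℝ, Finsupp.linearCombination ℝ v (η.weights + ε • τ) =
      Finsupp.linearCombination ℝ v η.weights + ε * Finsupp.linearCombination ℝ v τ := fun v => by
    rw [map_add, map_smul, smul_eq_mul]
  have hle := hmax (η.weights + ε • τ) (fun x => ?_) ?_ fun i => ?_
  · rw [hlc] at hle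
    nlinarith
  · by_cases hx : x ∈ τ.support
    · exact hε x hx
    · simpa [Finsupp.notMem_support_iff.1 hx] using hw0 x
  · rw [hlc, hw1, ← hi₀, hτu, mul_zero, add_zero]
  · rw [hlc, hwu, hτu, mul_zero, add_zero]

lemma le_index_of_sameMoments (hAB : A < B) {u : Fin k → Set.Icc A B → ℝ}
    (hu : IsChebyshevSystem u) {ξ η : Design A B} (hξ : (k : ℝ) / 2 ≤ ξ.index)
    (h : SameMoments u η ξ) : (k : ℝ) / 2 ≤ η.index := by
  by_contra! hη
  have := eq_of_sameMoments hAB hu hη fun i => (h i).symm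
  exact hη.not_ge (this ▸ hξ)

lemma ncard_supp_le_index_add_one (hAB : A < B) (ξ : Design A B) :
    (ξ.supp.ncard : ℝ) ≤ ξ.index + 1 := by
  rw [ncard_supp, index_eq_card_sub hAB]
  split_ifs <;> linarith

lemma mem_supp_iff (ξ : Design A B) (x : Set.Icc A B) :
    (x : ℝ) ∈ ξ.supp ↔ x ∈ ξ.weights.support := by
  rw [supp_eq]
  exact Finset.mem_map' (Function.Embedding.subtype _)

end Design

/-! ### Loewner comparison and forced endpoints -/

namespace Design

variable {A B : ℝ}

/-- All entries of `C` other than `(l, l)` are fixed by the lower moments, so the difference is a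
congruence by `P` of a nonnegative diagonal matrix. -/
lemma infoMatrix_le_of_sameMoments {p k : ℕ} {f : Set.Icc A B → EuclideanSpace ℝ (Fin p)}
    {P : Matrix (Fin p) (Fin p) ℝ} {Ψ : Fin p → Fin p → Set.Icc A B → ℝ}
    (hrep : ∀ ξ : Design A B, ξ.infoMatrix f = P * ξ.reducedMatrix Ψ * Pᵀ)
    {ψ : Fin (k + 1) → Set.Icc A B → ℝ} (hψ : IsEnumeration Ψ ψ)
    (hdef : OccursOnceOnDiagonal Ψ (ψ (Fin.last k))) {ξ η : Design A B}
    (h : SameMoments (Fin.init ψ) η ξ)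
    (hle : ∫ x, ψ (Fin.last k) x ∂ξ.measure ≤ ∫ x, ψ (Fin.last k) x ∂η.measure) :
    ξ.infoMatrix f ≤ η.infoMatrix f := by
  obtain ⟨l, hl, hne⟩ := hdef
  have := ξ.isProbabilityMeasure
  have := η.isProbabilityMeasure
  have hentry : ∀ i j, (i, j) ≠ (l, l) → ∫ x, Ψ i j x ∂η.measure = ∫ x, Ψ i j x ∂ξ.measure := by
    intro i j hij
    by_cases hc : ∃ c : ℝ, Ψ i j = fun _ => c
    · obtain ⟨c, hc⟩ := hc
      simp [hc]
    · have hmem : Ψ i j ∈ Set.range fun i : Fin k => ψ i.succ := by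
        rw [hψ.range_eq]
        exact ⟨⟨i, j, rfl⟩, hc⟩
      obtain ⟨m, hm⟩ := hmem
      have hlast : m.succ ≠ Fin.last k := fun h0 => hne i j hij (by rw [← hm, ← h0])
      have h1 := h (m.succ.castPred hlast)
      simp only [Fin.init, Fin.castSucc_castPred] at h1
      simpa only [← hm] using h1
  have hdiff : η.reducedMatrix Ψ - ξ.reducedMatrix Ψ = Matrix.diagonal (Pi.single l
      (∫ x, ψ (Fin.last k) x ∂η.measure - ∫ x, ψ (Fin.last k) x ∂ξ.measure)) := by
    ext i j
    rw [Matrix.sub_apply]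
    simp only [reducedMatrix, Matrix.of_apply]
    by_cases hij : (i, j) = (l, l)
    · obtain ⟨rfl, rfl⟩ := Prod.mk.inj hij
      rw [Matrix.diagonal_apply_eq, Pi.single_eq_same, hl]
    · rw [hentry i j hij, sub_self]
      by_cases h0 : i = j
      · subst h0
        rw [Matrix.diagonal_apply_eq, Pi.single_eq_of_ne (fun h => hij (by rw [h]))]
      · rw [Matrix.diagonal_apply_ne _ h0]
  rw [Matrix.le_iff, hrep, hrep, ← Matrix.sub_mul, ← Matrix.mul_sub, hdiff]
  have hpsd : (Matrix.diagonal (Pi.single l (∫ x, ψ (Fin.last k) x ∂η.measure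
      - ∫ x, ψ (Fin.last k) x ∂ξ.measure)) : Matrix (Fin p) (Fin p) ℝ).PosSemidef := by
    refine Matrix.PosSemidef.diagonal fun i => ?_
    by_cases hi : i = l
    · subst hi
      simpa using hle
    · simp [hi]
  simpa using hpsd.mul_mul_conjTranspose_same P

lemma exists_upper {k : ℕ} (hAB : A < B) (hk : 1 ≤ k) {ψ : Fin (k + 1) → Set.Icc A B → ℝ}
    (hone : ψ 0 = fun _ => 1) (hu : IsChebyshevSystem (Fin.init ψ)) (hψ : IsChebyshevSystem ψ)
    {ξ : Design A B} (hξ : (k : ℝ) / 2 ≤ ξ.index) :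
    ∃ η : Design A B, SameMoments (Fin.init ψ) η ξ ∧
      ∫ x, ψ (Fin.last k) x ∂ξ.measure ≤ ∫ x, ψ (Fin.last k) x ∂η.measure ∧
      (Odd k → (η.supp.ncard : ℝ) ≤ ((k : ℝ) + 1) / 2 ∧ B ∈ η.supp) ∧
      (Even k → (η.supp.ncard : ℝ) ≤ (k : ℝ) / 2 + 1 ∧ A ∈ η.supp ∧ B ∈ η.supp) := by
  classical
  -- The alternating measure is negative where `k + j` is odd, hence `s = (k + 1) % 2`. Then `k + s`
  -- is odd, so `B` may be adjoined, and for even `k` also `A`.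
  obtain ⟨η, hη, hle, hT⟩ := exists_extremal (u := Fin.init ψ) (g := ψ (Fin.last k))
    (s := (k + 1) % 2) hu.1 (hψ.1 _) ⟨⟨0, hk⟩, hone⟩ (fun y hy => by
      obtain ⟨τ, hτ, hτy, hτu, hτg⟩ := hu.exists_alternating hy
      refine ⟨τ, hτu, ?_, fun x hx => ?_⟩
      · rw [hτg, Fin.snoc_init_self]
        exact hψ.2 y hy
      · obtain ⟨j, rfl⟩ := hτy x hx.ne
        refine ⟨j, rfl, ?_⟩
        have h1 := hτ j
        by_contra h2
        have h3 : Even (k + j : ℕ) := by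
          rw [Nat.even_iff] at h2 ⊢
          omega
        rw [h3.neg_one_pow] at h1
        linarith) ξ
  refine ⟨η, hη, hle, ?_⟩
  have hidx := le_index_of_sameMoments hAB hu hξ hη
  rw [index_eq_card_sub hAB] at hidx
  set a : Set.Icc A B := ⟨A, Set.left_mem_Icc.2 hAB.le⟩ with ha
  set b : Set.Icc A B := ⟨B, Set.right_mem_Icc.2 hAB.le⟩ with hb
  have hab : a ≠ b := fun h => hAB.ne (congrArg Subtype.val h)
  rw [ncard_supp, show A ∈ η.supp ↔ a ∈ η.weights.support from η.mem_supp_iff a,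
    show B ∈ η.supp ↔ b ∈ η.weights.support from η.mem_supp_iff b]
  constructor
  · rintro ⟨m, hm⟩
    have hcard := hT (insert b η.weights.support) fun x hx => by
      rcases Finset.mem_insert.1 hx with rfl | hx
      · exact Or.inr (Or.inr ⟨Nat.odd_iff.2 (by omega), rfl⟩)
      · exact Or.inl (Finsupp.mem_support_iff.1 hx)
    have hcard' : (insert b η.weights.support).card ≤ m + 1 := by omega
    have hkm : (k : ℝ) = 2 * m + 1 := by exact_mod_cast hm
    by_cases hbm : b ∈ η.weights.support
    · rw [Finset.insert_eq_of_mem hbm] at hcard'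
      refine ⟨?_, hbm⟩
      have : (η.weights.support.card : ℝ) ≤ m + 1 := by exact_mod_cast hcard'
      linarith
    -- Without `B` there are at most `m` support points, so the index is below `k / 2 = m + 1 / 2`.
    · exfalso
      rw [Finset.card_insert_of_notMem hbm] at hcard'
      have : (η.weights.support.card : ℝ) ≤ m := by exact_mod_cast Nat.le_of_succ_le_succ hcard'
      split_ifs at hidx <;> linarith
  · rintro ⟨m, hm⟩
    have hcard := hT (insert a (insert b η.weights.support)) fun x hx => by
      rcases Finset.mem_insert.1 hx with rfl | hx
      · exact Or.inr (Or.inl ⟨by omega, rfl⟩)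
      · rcases Finset.mem_insert.1 hx with rfl | hx
        · exact Or.inr (Or.inr ⟨Nat.odd_iff.2 (by omega), rfl⟩)
        · exact Or.inl (Finsupp.mem_support_iff.1 hx)
    have hcard' : (insert a (insert b η.weights.support)).card ≤ m + 1 := by omega
    have hkm : (k : ℝ) = m + m := by exact_mod_cast hm
    have hcardR : ((insert a (insert b η.weights.support)).card : ℝ) ≤ m + 1 := by
      exact_mod_cast hcard'
    have hmem : a ∈ insert b η.weights.support ↔ a ∈ η.weights.support := by
      rw [Finset.mem_insert, or_iff_right hab]
    -- The bound `m + 1` includes the missing endpoints, so each of these pushes the index one half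
    -- below `m = k / 2`.
    by_cases ham : a ∈ η.weights.support <;> by_cases hbm : b ∈ η.weights.support <;>
      simp only [Finset.card_insert_eq_ite, hmem, ham, hbm, if_true, if_false, Nat.cast_add,
        Nat.cast_one] at hcardR hidx
    · exact ⟨by linarith, ham, hbm⟩
    all_goals exfalso; linarith

lemma exists_lower {k : ℕ} (hAB : A < B) (hk : 1 ≤ k) {ψ : Fin (k + 1) → Set.Icc A B → ℝ}
    (hone : ψ 0 = fun _ => 1) (hu : IsChebyshevSystem (Fin.init ψ))
    (hψ : IsChebyshevSystem (Function.update ψ (Fin.last k) (-ψ (Fin.last k))))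
    {ξ : Design A B} (hξ : (k : ℝ) / 2 ≤ ξ.index) :
    ∃ η : Design A B, SameMoments (Fin.init ψ) η ξ ∧
      ∫ x, ψ (Fin.last k) x ∂ξ.measure ≤ ∫ x, ψ (Fin.last k) x ∂η.measure ∧
      (Odd k → (η.supp.ncard : ℝ) ≤ ((k : ℝ) + 1) / 2 ∧ A ∈ η.supp) ∧
      (Even k → (η.supp.ncard : ℝ) ≤ (k : ℝ) / 2) := by
  classical
  have hcont : Continuous (ψ (Fin.last k)) := by
    have := hψ.1 (Fin.last k)
    rw [Function.update_self] at this
    simpa using this.neg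
  have hsnoc : (Fin.snoc (Fin.init ψ) (-ψ (Fin.last k)) : Fin (k + 1) → Set.Icc A B → ℝ) =
      Function.update ψ (Fin.last k) (-ψ (Fin.last k)) := by
    rw [← Fin.snoc_init_self (Function.update ψ (Fin.last k) (-ψ (Fin.last k))),
      Fin.init_update_last, Function.update_self]
  -- Now `-τ` increases the integral and is negative where `k + j` is even, hence `s = k % 2`: `A`
  -- may be adjoined for odd `k`, no endpoint for even `k`.
  obtain ⟨η, hη, hle, hT⟩ := exists_extremal (u := Fin.init ψ) (g := ψ (Fin.last k))
    (s := k % 2) hu.1 hcont ⟨⟨0, hk⟩, hone⟩ (fun y hy => by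
      obtain ⟨τ, hτ, hτy, hτu, hτg⟩ := hu.exists_alternating hy
      refine ⟨-τ, fun i => by rw [map_neg, hτu, neg_zero], ?_, fun x hx => ?_⟩
      · have h1 := hψ.2 y hy
        rw [← hsnoc, ← hτg] at h1
        simpa [Finsupp.linearCombination_apply, Finsupp.sum] using h1
      · rw [Finsupp.neg_apply] at hx
        obtain ⟨j, rfl⟩ := hτy x (by linarith : (0 : ℝ) < τ x).ne'
        refine ⟨j, rfl, ?_⟩
        have h1 := hτ j
        by_contra h2
        have h3 : Odd (k + j : ℕ) := by
          rw [Nat.even_iff] at h2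
          rw [Nat.odd_iff]
          omega
        rw [h3.neg_one_pow] at h1
        linarith) ξ
  refine ⟨η, hη, hle, ?_⟩
  have hidx := le_index_of_sameMoments hAB hu hξ hη
  rw [index_eq_card_sub hAB] at hidx
  set a : Set.Icc A B := ⟨A, Set.left_mem_Icc.2 hAB.le⟩ with ha
  rw [ncard_supp, show A ∈ η.supp ↔ a ∈ η.weights.support from η.mem_supp_iff a]
  constructor
  · rintro ⟨m, hm⟩
    have hcard := hT (insert a η.weights.support) fun x hx => by
      rcases Finset.mem_insert.1 hx with rfl | hx
      · exact Or.inr (Or.inl ⟨by omega, rfl⟩)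
      · exact Or.inl (Finsupp.mem_support_iff.1 hx)
    have hcard' : (insert a η.weights.support).card ≤ m + 1 := by omega
    have hkm : (k : ℝ) = 2 * m + 1 := by exact_mod_cast hm
    by_cases ham : a ∈ η.weights.support
    · rw [Finset.insert_eq_of_mem ham] at hcard'
      refine ⟨?_, ham⟩
      have : (η.weights.support.card : ℝ) ≤ m + 1 := by exact_mod_cast hcard'
      linarith
    · exfalso
      rw [Finset.card_insert_of_notMem ham] at hcard'
      have : (η.weights.support.card : ℝ) ≤ m := by exact_mod_cast Nat.le_of_succ_le_succ hcard'
      split_ifs at hidx <;> linarith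
  · rintro ⟨m, hm⟩
    have hcard := hT η.weights.support fun x hx => Or.inl (Finsupp.mem_support_iff.1 hx)
    have hcard' : η.weights.support.card ≤ m := by omega
    have hkm : (k : ℝ) = m + m := by exact_mod_cast hm
    have : (η.weights.support.card : ℝ) ≤ m := by exact_mod_cast hcard'
    linarith

end Design

theorem theorem3p1 {A B : ℝ} (hAB : A < B) {p k : ℕ} (hk : 1 ≤ k)
    -- the regression function, its parameter set, and its gradient at the fixed parameter `θ`
    (Θ : Set (EuclideanSpace ℝ (Fin p))) (reg : Set.Icc A B → EuclideanSpace ℝ (Fin p) → ℝ)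
    (hreg_cont : ContinuousOn (fun q : Set.Icc A B × EuclideanSpace ℝ (Fin p) => reg q.1 q.2)
      (Set.univ ×ˢ Θ))
    (hreg_diff : ∀ x, DifferentiableOn ℝ (reg x) Θ)
    (θ : EuclideanSpace ℝ (Fin p)) (hθ : θ ∈ Θ)
    (f : Set.Icc A B → EuclideanSpace ℝ (Fin p))
    (hf : ∀ x, HasGradientWithinAt (reg x) (f x) Θ θ)
    -- the representation of the information matrix
    (P : Matrix (Fin p) (Fin p) ℝ) (hP : IsUnit P)
    (Ψ : Fin p → Fin p → Set.Icc A B → ℝ)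
    (hrep : ∀ ξ : Design A B, ξ.infoMatrix f = P * ξ.reducedMatrix Ψ * Pᵀ)
    (ψ : Fin (k + 1) → Set.Icc A B → ℝ) (hψ : IsEnumeration Ψ ψ)
    (hdef : OccursOnceOnDiagonal Ψ (ψ (Fin.last k))) :
    (IsChebyshevSystem (Fin.init ψ) → IsChebyshevSystem ψ →
      ∀ ξ : Design A B, ∃ ξp : Design A B,
        (ξp.supp.ncard : ℝ) ≤ ((k : ℝ) + 2) / 2 ∧
        ξ.infoMatrix f ≤ ξp.infoMatrix f ∧
        (ξ.index < (k : ℝ) / 2 →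
          ξp = ξ ∧ ∀ η : Design A B, Design.SameMoments (Fin.init ψ) η ξ → η = ξp) ∧
        ((k : ℝ) / 2 ≤ ξ.index →
          (Odd k → (ξp.supp.ncard : ℝ) ≤ ((k : ℝ) + 1) / 2 ∧ B ∈ ξp.supp) ∧
          (Even k → (ξp.supp.ncard : ℝ) ≤ (k : ℝ) / 2 + 1 ∧ A ∈ ξp.supp ∧ B ∈ ξp.supp))) ∧
    (IsChebyshevSystem (Fin.init ψ) →
      IsChebyshevSystem (Function.update ψ (Fin.last k) (-ψ (Fin.last k))) →
      ∀ ξ : Design A B, ∃ ξm : Design A B,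
        (ξm.supp.ncard : ℝ) ≤ ((k : ℝ) + 2) / 2 ∧
        ξ.infoMatrix f ≤ ξm.infoMatrix f ∧
        (ξ.index < (k : ℝ) / 2 →
          ξm = ξ ∧ ∀ η : Design A B, Design.SameMoments (Fin.init ψ) η ξ → η = ξm) ∧
        ((k : ℝ) / 2 ≤ ξ.index →
          (Odd k → (ξm.supp.ncard : ℝ) ≤ ((k : ℝ) + 1) / 2 ∧ A ∈ ξm.supp) ∧
          (Even k → (ξm.supp.ncard : ℝ) ≤ (k : ℝ) / 2))) := by
  have small : IsChebyshevSystem (Fin.init ψ) → ∀ ξ : Design A B, ξ.index < (k : ℝ) / 2 →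
      (ξ.supp.ncard : ℝ) ≤ ((k : ℝ) + 2) / 2 ∧
      ∀ η : Design A B, Design.SameMoments (Fin.init ψ) η ξ → η = ξ := fun hu ξ hξ =>
    ⟨by linarith [ξ.ncard_supp_le_index_add_one hAB], fun η h => Design.eq_of_sameMoments hAB hu hξ h⟩
  refine ⟨fun hu hv ξ => ?_, fun hu hv ξ => ?_⟩
  · rcases lt_or_ge ξ.index ((k : ℝ) / 2) with hξ | hξ
    · exact ⟨ξ, (small hu ξ hξ).1, le_rfl, fun _ => ⟨rfl, (small hu ξ hξ).2⟩,
        fun h => absurd h hξ.not_ge⟩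
    · obtain ⟨η, hη, hle, hodd, heven⟩ := Design.exists_upper hAB hk hψ.zero hu hv hξ
      refine ⟨η, ?_, Design.infoMatrix_le_of_sameMoments hrep hψ hdef hη hle,
        fun h => absurd hξ h.not_ge, fun _ => ⟨hodd, heven⟩⟩
      rcases Nat.even_or_odd k with h | h
      · linarith [(heven h).1]
      · linarith [(hodd h).1]
  · rcases lt_or_ge ξ.index ((k : ℝ) / 2) with hξ | hξ
    · exact ⟨ξ, (small hu ξ hξ).1, le_rfl, fun _ => ⟨rfl, (small hu ξ hξ).2⟩,
        fun h => absurd h hξ.not_ge⟩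
    · obtain ⟨η, hη, hle, hodd, heven⟩ := Design.exists_lower hAB hk hψ.zero hu hv hξ
      refine ⟨η, ?_, Design.infoMatrix_le_of_sameMoments hrep hψ hdef hη hle,
        fun h => absurd hξ h.not_ge, fun _ => ⟨hodd, heven⟩⟩
      rcases Nat.even_or_odd k with h | h
      · linarith [heven h]
      · linarith [(hodd h).1]
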